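/- **Theorem (optimality of commutator simulation).** For states (density matrices) $\rho_1,\rho_2$ on $\mathbb{C}^d$ let $H=i[\rho_1,\rho_2]=i(\rho_1\rho_2-\rho_2\rho_1)$. Let $t\neq 0$ and $\delta>0$ be real. A protocol using $n_1$ copies of $\rho_1$ and $n_2$ copies of $\rho_2$ is a quantum channel (a completely positive trace-preserving map) $P$ from operators on $\mathbb{C}^d\otimes(\mathbb{C}^d)^{\otimes n_1}\otimes(\mathbb{C}^d)^{\otimes n_2}$ to operators on $\mathbb{C}^d$. It *simulates $i[\rho_1,\rho_2]$ for time $t$ to trace norm error $\delta$* if, for all states $\rho_1,\rho_2$ on $\mathbb{C}^d$, $$\frac12\max_{\sigma}\left\|P\big(\sigma\otimes\rho_1^{\otimes n_1}\otimes\rho_2^{\otimes n_2}\big)-e^{-iHt}\,\sigma\,e^{iHt}\right\|_1\le\delta,$$ where $\sigma$ ranges over the states on $\mathbb{C}^d$ and $\|A\|_1=\operatorname{Tr}\sqrt{AA^\dagger}$. There are absolute constants $C,\delta_0,\kappa>0$ such that for every $d\ge 2$ and all real $t\ne 0$ and $0<\delta\le\delta_0$ with $\delta/|t|\le\kappa$,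 every protocol that simulates $i[\rho_1,\rho_2]$ for time $t$ to trace norm error $\delta$ uses $$n_1\ge C\,\frac{t^2}{\delta}\qquad\text{and}\qquad n_2\ge C\,\frac{t^2}{\delta}$$ copies of $\rho_1$ and of $\rho_2$, respectively. -/

import Mathlib

open scoped ComplexOrder MatrixOrder Matrix.Norms.L2Operator CStarAlgebra Kronecker

/-- `ρ ∈ D(ℋ)`: a positive semidefinite operator of trace one, as a matrix in an orthonormal
basis of `ℋ` indexed by `ι`. -/
def IsDensity {ι : Type*} [Fintype ι] (ρ : Matrix ι ι ℂ) : Prop :=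
  ρ.PosSemidef ∧ ρ.trace = 1

/-- The trace norm `‖A‖₁ = Tr √(A A†)`. -/
noncomputable def traceNorm {ι : Type*} [Fintype ι] [DecidableEq ι] (A : Matrix ι ι ℂ) : ℝ :=
  (CFC.sqrt (A * A.conjTranspose)).trace.re

/-- The state `ρ ⊗ ⋯ ⊗ ρ` of `n` registers, each holding a copy of `ρ`. -/
def copies {ι : Type*} (ρ : Matrix ι ι ℂ) (n : ℕ) : Matrix (Fin n → ι) (Fin n → ι) ℂ :=
  Matrix.of fun x y => ∏ k, ρ (x k) (y k)

/-- A quantum channel: a completely positive trace-preserving linear map. -/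
structure QuantumChannel (ι κ : Type*) [Fintype ι] [DecidableEq ι] [Fintype κ] [DecidableEq κ]
    extends Matrix ι ι ℂ →CP Matrix κ κ ℂ where
  trace_map (A : Matrix ι ι ℂ) : (toFun A).trace = A.trace

/-- The commutator Hamiltonian `i[ρ₁, ρ₂] = i(ρ₁ρ₂ - ρ₂ρ₁)`. -/
noncomputable def commHamiltonian {ι : Type*} [Fintype ι] (ρ₁ ρ₂ : Matrix ι ι ℂ) :
    Matrix ι ι ℂ :=
  Complex.I • (ρ₁ * ρ₂ - ρ₂ * ρ₁)

/-- The state `e^{-iHt} σ e^{iHt}`: `σ` evolved under the Hamiltonian `H` for time `t`. -/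
noncomputable def evolve {ι : Type*} [Fintype ι] [DecidableEq ι]
    (H : Matrix ι ι ℂ) (t : ℝ) (σ : Matrix ι ι ℂ) : Matrix ι ι ℂ :=
  NormedSpace.exp ((-(Complex.I * (t : ℂ))) • H) * σ * NormedSpace.exp ((Complex.I * (t : ℂ)) • H)

/-- A procedure that is given a register of the system (with index set `ι`) together with `n₁`
registers holding copies of a first state and `n₂` registers holding copies of a second state,
and that outputs a register of the system: an arbitrary quantum channel. -/
abbrev SampleProtocol (ι : Type*) [Fintype ι] [DecidableEq ι] (n₁ n₂ : ℕ) :=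
  QuantumChannel (ι × (Fin n₁ → ι) × (Fin n₂ → ι)) ι

/-- The protocol `P` simulates `i[ρ₁, ρ₂]` for time `t` to error `δ` in trace norm distance:
whatever the (unknown) states `ρ₁`, `ρ₂` are, the channel
`σ ↦ P (σ ⊗ ρ₁^{⊗ n₁} ⊗ ρ₂^{⊗ n₂})` is within
`½ max_σ ‖·‖₁ ≤ δ` of the unitary channel `σ ↦ e^{-iHt} σ e^{iHt}`, `H = i[ρ₁, ρ₂]`. -/
def SimulatesCommutator {ι : Type*} [Fintype ι] [DecidableEq ι] {n₁ n₂ : ℕ}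
    (P : SampleProtocol ι n₁ n₂) (t δ : ℝ) : Prop :=
  ∀ ρ₁ ρ₂ : Matrix ι ι ℂ, IsDensity ρ₁ → IsDensity ρ₂ →
    ∀ σ : Matrix ι ι ℂ, IsDensity σ →
      (1 / 2) * traceNorm
        (P.toCompletelyPositiveMap (σ ⊗ₖ (copies ρ₁ n₁ ⊗ₖ copies ρ₂ n₂))
          - evolve (commHamiltonian ρ₁ ρ₂) t σ) ≤ δ

/-! A cheap simulation would distinguish nearby states too well. Running the protocol `m ≈ 1/(16δ)`
times in succession keeps the total error at most `1/16`. Fix one input as a pure qubit state and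
tilt the other by `ε` or `-ε`: the commutators generate opposite rotations of a plane, and `ε =
π/(2mt)` makes `m` runs carry a common initial state nearly to orthogonal lines, at angles `±π/4`.

Distinguishability is controlled without purifications. Square roots of the two supplied states form
a positive 2×2 block matrix, and complete positivity preserves its positivity under the iteration
(`blockIterate_nonneg`). Trace preservation makes the off-diagonal trace the `m`-th power of the
overlap (`trace_blockIterate`), while near orthogonality of the diagonal blocks keeps it at most
`1/2` (`re_trace_offDiag_le_half`). For the tilted states this reads `(1 - ε²)^(nm/2) ≤ 1/2`, so
`nmε² ≥ 3/4` by Bernoulli, that is, `n` is at least of order `mt²`, hence `t²/δ`. -/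

section Copies

variable {ι : Type*} (n : ℕ)

theorem copies_mul [Fintype ι] (A B : Matrix ι ι ℂ) :
    copies (A * B) n = copies A n * copies B n := by
  ext x y
  simp only [copies, Matrix.of_apply, Matrix.mul_apply, Finset.prod_univ_sum,
    Fintype.piFinset_univ, Finset.prod_mul_distrib]

theorem trace_copies [Fintype ι] (A : Matrix ι ι ℂ) : (copies A n).trace = A.trace ^ n := by
  simp only [copies, Matrix.trace, Matrix.diag_apply, Matrix.of_apply]
  rw [← Fin.prod_const, Finset.prod_univ_sum, Fintype.piFinset_univ]

theorem conjTranspose_copies (A : Matrix ι ι ℂ) : (copies A n).conjTranspose =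
    copies A.conjTranspose n := by
  ext x y
  simp [copies, Matrix.conjTranspose_apply, star_prod]

end Copies

/-! ### Projections, traces and one-sided error bounds. -/

section TraceInequalities

variable {ι : Type*} [Fintype ι] [DecidableEq ι]

omit [DecidableEq ι] in
theorem re_trace_mul_nonneg {Q A : Matrix ι ι ℂ} (hQ : IsStarProjection Q) (hA : 0 ≤ A) :
    0 ≤ (Q * A).trace.re := by
  have h : (Q * A).trace = (Q * A * star Q).trace := by
    rw [Matrix.trace_mul_comm (Q * A), hQ.isSelfAdjoint.star_eq, ← mul_assoc,
      hQ.isIdempotentElem.eq]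
  rw [h]
  exact (Complex.le_def.1
    (Matrix.PosSemidef.mul_mul_conjTranspose_same (Matrix.nonneg_iff_posSemidef.1 hA) Q).trace_nonneg).1

theorem re_trace_mul_le_re_trace {Q A : Matrix ι ι ℂ} (hQ : IsStarProjection Q) (hA : 0 ≤ A) :
    (Q * A).trace.re ≤ A.trace.re := by
  have h := re_trace_mul_nonneg hQ.one_sub hA
  rw [sub_mul, one_mul, Matrix.trace_sub, Complex.sub_re] at h
  linarith

theorem re_trace_mul_le_of_le_add {Q A B R : Matrix ι ι ℂ} (hQ : IsStarProjection Q)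
    (hQB : Q * B = 0) (hR : 0 ≤ R) (h : A ≤ B + R) : (Q * A).trace.re ≤ R.trace.re := by
  have h1 := re_trace_mul_nonneg hQ (sub_nonneg.2 h)
  rw [mul_sub, mul_add, hQB, zero_add, Matrix.trace_sub, Complex.sub_re] at h1
  linarith [re_trace_mul_le_re_trace hQ hR]

/-- The positive part of `A - B` serves as `R`: since `A - B` is traceless, its positive part
carries exactly half the trace norm. An order bound survives positive maps, so no contractivity of
the trace norm is needed later. -/
theorem exists_le_add_of_traceNorm {A B : Matrix ι ι ℂ} {δ : ℝ} (hA : A.IsHermitian)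
    (hB : B.IsHermitian) (hAB : A.trace = B.trace) (h : (1 / 2) * traceNorm (A - B) ≤ δ) :
    ∃ R : Matrix ι ι ℂ, 0 ≤ R ∧ A ≤ B + R ∧ R.trace.re ≤ δ := by
  have hD : IsSelfAdjoint (A - B) := hA.sub hB
  refine ⟨(A - B)⁺, CFC.posPart_nonneg _, ?_, ?_⟩
  · rw [← sub_le_iff_le_add']
    exact CFC.le_posPart hD
  · have h1 : traceNorm (A - B) = (CFC.abs (A - B)).trace.re := by
      rw [traceNorm, CFC.abs, ← Matrix.star_eq_conjTranspose, hD.star_eq]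
    have h2 := congrArg (fun M => M.trace.re) (CFC.abs_add_self (A - B) hD)
    simp only [two_nsmul, Matrix.trace_add, Matrix.trace_sub, hAB, sub_self, Complex.add_re,
      add_zero] at h2
    linarith

end TraceInequalities

/-! ### Positive 2×2 block matrices. -/

section BlockMatrices

theorem CStarAlgebra.exists_eq_star_mul_self {A : Type*} [NonUnitalCStarAlgebra A]
    [PartialOrder A] [StarOrderedRing A] {a : A} (ha : 0 ≤ a) : ∃ b, a = star b * b :=
  CStarAlgebra.nonneg_iff_eq_star_mul_self.1 ha

variable {ι κ : Type*} [Fintype ι] [DecidableEq ι] [Fintype κ] [DecidableEq κ]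

theorem exists_apply_eq_sum_of_nonneg {M : CStarMatrix (Fin 2) (Fin 2) (Matrix ι ι ℂ)}
    (hM : 0 ≤ M) : ∃ X : CStarMatrix (Fin 2) (Fin 2) (Matrix ι ι ℂ),
      ∀ i j, M i j = ∑ k, star (X k i) * X k j := by
  obtain ⟨X, rfl⟩ := CStarAlgebra.exists_eq_star_mul_self hM
  refine ⟨X, fun i j => ?_⟩
  simp [CStarMatrix.mul_apply, CStarMatrix.star_apply]

theorem blockRow_nonneg (Y : Fin 2 → Matrix ι ι ℂ) :
    (0 : CStarMatrix (Fin 2) (Fin 2) (Matrix ι ι ℂ)) ≤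
      CStarMatrix.ofMatrix (Matrix.of fun i j => star (Y i) * Y j) := by
  let X : CStarMatrix (Fin 2) (Fin 2) (Matrix ι ι ℂ) :=
    CStarMatrix.ofMatrix (Matrix.of fun k j => if k = 0 then Y j else 0)
  have h := star_mul_self_nonneg X
  convert h using 1
  ext1 i j
  simp [X, CStarMatrix.mul_apply, CStarMatrix.star_apply]

/-- Factoring `M` as `X†X` exhibits the result as a sum over `k` of Gram matrices of the rows `X k i
⊗ₖ Y i`. -/
theorem blockKronecker_nonneg {M : CStarMatrix (Fin 2) (Fin 2) (Matrix ι ι ℂ)} (hM : 0 ≤ M)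
    (Y : Fin 2 → Matrix κ κ ℂ) :
    (0 : CStarMatrix (Fin 2) (Fin 2) (Matrix (ι × κ) (ι × κ) ℂ)) ≤
      CStarMatrix.ofMatrix (Matrix.of fun i j => M i j ⊗ₖ (star (Y i) * Y j)) := by
  obtain ⟨X, hX⟩ := exists_apply_eq_sum_of_nonneg hM
  have h : CStarMatrix.ofMatrix (Matrix.of fun i j => M i j ⊗ₖ (star (Y i) * Y j)) =
      ∑ k, CStarMatrix.ofMatrix
        (Matrix.of fun i j => star (X k i ⊗ₖ Y i) * (X k j ⊗ₖ Y j)) := by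
    ext1 i j
    simp only [hX, Fin.sum_univ_two, Matrix.add_kronecker, CStarMatrix.add_apply,
      CStarMatrix.ofMatrix_apply, Matrix.of_apply, Matrix.star_eq_conjTranspose,
      Matrix.conjTranspose_kronecker, Matrix.mul_kronecker_mul]
  rw [h]
  exact Finset.sum_nonneg fun k _ => blockRow_nonneg fun i => X k i ⊗ₖ Y i

/-- A weighted AM-GM inequality: the difference is a sum of squares of `a • X k 0 - b • X k 1`. -/
theorem weighted_offDiag_le {M : CStarMatrix (Fin 2) (Fin 2) (Matrix ι ι ℂ)} (hM : 0 ≤ M)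
    {a b : ℝ} (hab : a * b = 1) :
    M 0 1 + M 1 0 ≤ (a ^ 2) • M 0 0 + (b ^ 2) • M 1 1 := by
  obtain ⟨X, hX⟩ := exists_apply_eq_sum_of_nonneg hM
  have h : (a ^ 2) • M 0 0 + (b ^ 2) • M 1 1 - (M 0 1 + M 1 0) =
      ∑ k, star (a • X k 0 - b • X k 1) * (a • X k 0 - b • X k 1) := by
    simp only [hX, star_sub, star_smul, star_trivial, sub_mul, mul_sub, smul_mul_smul_comm,
      mul_comm b a, hab, Fin.sum_univ_two, one_smul, smul_add, ← pow_two]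
    abel
  rw [← sub_nonneg, h]
  exact Finset.sum_nonneg fun k _ => star_mul_self_nonneg _

theorem offDiag_star {M : CStarMatrix (Fin 2) (Fin 2) (Matrix ι ι ℂ)} (hM : 0 ≤ M) :
    M 1 0 = star (M 0 1) := by
  obtain ⟨X, hX⟩ := exists_apply_eq_sum_of_nonneg hM
  simp [hX]

theorem two_mul_re_trace_mul_offDiag_le {M : CStarMatrix (Fin 2) (Fin 2) (Matrix ι ι ℂ)}
    (hM : 0 ≤ M) {Q : Matrix ι ι ℂ} (hQ : IsStarProjection Q) {a b : ℝ} (hab : a * b = 1) :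
    2 * (Q * M 0 1).trace.re ≤ a ^ 2 * (Q * M 0 0).trace.re + b ^ 2 * (Q * M 1 1).trace.re := by
  have h := re_trace_mul_nonneg hQ (sub_nonneg.2 (weighted_offDiag_le hM hab))
  have h1 : (Q * M 1 0).trace.re = (Q * M 0 1).trace.re := by
    rw [offDiag_star hM, Matrix.trace_mul_comm, ← hQ.isSelfAdjoint.star_eq, ← star_mul,
      Matrix.star_eq_conjTranspose, Matrix.trace_conjTranspose, hQ.isSelfAdjoint.star_eq]
    simp
  simp only [mul_sub, mul_add, Matrix.trace_sub, Matrix.trace_add, Complex.sub_re, Complex.add_re,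
    mul_smul_comm, Matrix.trace_smul, Complex.real_smul, Complex.re_ofReal_mul, h1] at h
  linarith

/-- If a projection almost separates the diagonal blocks of a positive block matrix, then the
trace of the off-diagonal block is bounded away from one. -/
theorem re_trace_offDiag_le_half {M : CStarMatrix (Fin 2) (Fin 2) (Matrix ι ι ℂ)}
    (hM : 0 ≤ M) (h0 : (M 0 0).trace = 1) (h1 : (M 1 1).trace = 1) (hp : 0 ≤ M 0 0)
    (hq : 0 ≤ M 1 1) {Q : Matrix ι ι ℂ} (hQ : IsStarProjection Q)
    (hQ0 : (Q * M 0 0).trace.re ≤ 1 / 16) (hQ1 : ((1 - Q) * M 1 1).trace.re ≤ 1 / 16) :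
    (M 0 1).trace.re ≤ 1 / 2 := by
  -- The large weight goes to the diagonal block that is small under the projection: each half
  -- contributes at most `4 · 1/16 + 1/4 = 1/2`.
  have e1 := two_mul_re_trace_mul_offDiag_le hM hQ (a := 2) (b := 1 / 2) (by norm_num)
  have e2 := two_mul_re_trace_mul_offDiag_le hM hQ.one_sub (a := 1 / 2) (b := 2) (by norm_num)
  have e3 := re_trace_mul_le_re_trace hQ hq
  have e4 := re_trace_mul_le_re_trace hQ.one_sub hp
  have e5 : ((1 - Q) * M 0 1).trace.re = (M 0 1).trace.re - (Q * M 0 1).trace.re := by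
    simp [sub_mul]
  simp only [h0, h1, Complex.one_re] at e3 e4
  linarith

end BlockMatrices

theorem sub_kronecker {l m n p : Type*} (A B : Matrix l m ℂ) (C : Matrix n p ℂ) :
    (A - B) ⊗ₖ C = A ⊗ₖ C - B ⊗ₖ C := by
  rw [eq_sub_iff_add_eq, ← Matrix.add_kronecker, sub_add_cancel]

/-! ### Iterating a channel on block matrices. -/

section Channels

variable {ι κ : Type*} [Fintype ι] [DecidableEq ι] [Fintype κ] [DecidableEq κ]

/-- The positive block matrix obtained from the constant block matrix with entries `σ` by `k`
times tensoring the block `(i, j)` with `(Y i)† (Y j)` and applying the channel `P`. -/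
noncomputable def blockIterate (P : QuantumChannel (ι × κ) ι) (Y : Fin 2 → Matrix κ κ ℂ)
    (σ : Matrix ι ι ℂ) : ℕ → CStarMatrix (Fin 2) (Fin 2) (Matrix ι ι ℂ)
  | 0 => CStarMatrix.ofMatrix (Matrix.of fun _ _ => σ)
  | k + 1 => CStarMatrix.map (CStarMatrix.ofMatrix
      (Matrix.of fun i j => blockIterate P Y σ k i j ⊗ₖ (star (Y i) * Y j))) P.toLinearMap

variable {P : QuantumChannel (ι × κ) ι} {Y : Fin 2 → Matrix κ κ ℂ} {σ : Matrix ι ι ℂ}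

theorem blockIterate_succ_apply (k : ℕ) (i j : Fin 2) :
    blockIterate P Y σ (k + 1) i j =
      P.toCompletelyPositiveMap (blockIterate P Y σ k i j ⊗ₖ (star (Y i) * Y j)) := rfl

theorem blockIterate_nonneg (hσ : 0 ≤ σ) (k : ℕ) : 0 ≤ blockIterate P Y σ k := by
  induction k with
  | zero =>
    obtain ⟨s, rfl⟩ := CStarAlgebra.exists_eq_star_mul_self hσ
    exact blockRow_nonneg fun _ => s
  | succ k ih => exact P.map_cstarMatrix_nonneg' 2 _ (blockKronecker_nonneg ih Y)

theorem blockIterate_diag_nonneg (hσ : 0 ≤ σ) (k : ℕ) (i : Fin 2) :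
    0 ≤ blockIterate P Y σ k i i := by
  obtain ⟨X, hX⟩ := exists_apply_eq_sum_of_nonneg (blockIterate_nonneg (P := P) (Y := Y) hσ k)
  rw [hX]
  exact Finset.sum_nonneg fun k _ => star_mul_self_nonneg _

theorem trace_blockIterate (k : ℕ) (i j : Fin 2) :
    (blockIterate P Y σ k i j).trace = σ.trace * (star (Y i) * Y j).trace ^ k := by
  induction k with
  | zero => simp [blockIterate]
  | succ k ih =>
    rw [blockIterate_succ_apply, pow_succ, ← mul_assoc, ← ih, ← Matrix.trace_kronecker]
    exact P.trace_map _

theorem QuantumChannel.map_nonneg (P : QuantumChannel ι κ) {A : Matrix ι ι ℂ} (hA : 0 ≤ A) :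
    0 ≤ P.toCompletelyPositiveMap A :=
  _root_.map_nonneg P.toCompletelyPositiveMap hA

/-- Errors add linearly: the channel preserves the trace of the old remainder, and each use adds a
fresh one of trace at most `δ`. -/
theorem blockIterate_le_add {τ : ℕ → Matrix ι ι ℂ} {δ : ℝ} {i : Fin 2}
    (hY : (star (Y i) * Y i).trace = 1) (hτ : ∀ k, IsDensity (τ k))
    (h : ∀ k, (1 / 2) * traceNorm
      (P.toCompletelyPositiveMap (τ k ⊗ₖ (star (Y i) * Y i)) - τ (k + 1)) ≤ δ) (k : ℕ) :
    ∃ R : Matrix ι ι ℂ, 0 ≤ R ∧ blockIterate P Y (τ 0) k i i ≤ τ k + R ∧ R.trace.re ≤ k * δ := by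
  have hYY : (star (Y i) * Y i).PosSemidef :=
    Matrix.nonneg_iff_posSemidef.1 (star_mul_self_nonneg _)
  induction k with
  | zero => exact ⟨0, le_rfl, by simp [blockIterate], by simp⟩
  | succ k ih =>
    obtain ⟨R, hR, hle, htr⟩ := ih
    have hpos : 0 ≤ P.toCompletelyPositiveMap (τ k ⊗ₖ (star (Y i) * Y i)) :=
      P.map_nonneg (Matrix.nonneg_iff_posSemidef.2 ((hτ k).1.kronecker hYY))
    obtain ⟨S, hS, hSle, hStr⟩ := exists_le_add_of_traceNorm
      (Matrix.nonneg_iff_posSemidef.1 hpos).isHermitian (hτ (k + 1)).1.isHermitian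
      (by
        rw [(hτ (k + 1)).2]
        exact (P.trace_map _).trans (by rw [Matrix.trace_kronecker, (hτ k).2, hY, one_mul])) (h k)
    refine ⟨P.toCompletelyPositiveMap (R ⊗ₖ (star (Y i) * Y i)) + S,
      add_nonneg (P.map_nonneg (Matrix.nonneg_iff_posSemidef.2
        ((Matrix.nonneg_iff_posSemidef.1 hR).kronecker hYY))) hS, ?_, ?_⟩
    · have h1 := P.map_nonneg (Matrix.nonneg_iff_posSemidef.2
        (Matrix.PosSemidef.kronecker (Matrix.le_iff.1 hle) hYY))
      rw [sub_kronecker, Matrix.add_kronecker, map_sub, map_add,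
        ← blockIterate_succ_apply, sub_nonneg] at h1
      calc _ ≤ _ := h1
        _ ≤ _ := add_le_add_left hSle _
        _ = _ := by abel
    · have h2 : (P.toCompletelyPositiveMap (R ⊗ₖ (star (Y i) * Y i))).trace = R.trace :=
        (P.trace_map _).trans (by rw [Matrix.trace_kronecker, hY, mul_one])
      rw [Matrix.trace_add, h2, Complex.add_re]
      push_cast
      linarith

/-- If `m` uses of a channel, supplied with the states `(Y i)† (Y i)`, steer the same initial
state to within total error `1 / 16` of orthogonal states, then the `m`-th power of the
overlap of the supplied states is at most one half. -/
theorem re_overlap_pow_le_half {τ : Fin 2 → ℕ → Matrix ι ι ℂ} {δ : ℝ} {m : ℕ}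
    (hY : ∀ i, (star (Y i) * Y i).trace = 1) (hτ : ∀ i k, IsDensity (τ i k))
    (h : ∀ i k, (1 / 2) * traceNorm
      (P.toCompletelyPositiveMap (τ i k ⊗ₖ (star (Y i) * Y i)) - τ i (k + 1)) ≤ δ)
    (h0 : τ 0 0 = τ 1 0) (hproj : IsStarProjection (τ 1 m)) (horth : τ 1 m * τ 0 m = 0)
    (hm : m * δ ≤ 1 / 16) : ((star (Y 0) * Y 1).trace ^ m).re ≤ 1 / 2 := by
  have hσ : 0 ≤ τ 0 0 := Matrix.nonneg_iff_posSemidef.2 (hτ 0 0).1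
  obtain ⟨R, hR, hRle, hRtr⟩ := blockIterate_le_add (hY 0) (hτ 0) (h 0) m
  obtain ⟨S, hS, hSle, hStr⟩ := blockIterate_le_add (hY 1) (hτ 1) (h 1) m
  rw [← h0] at hSle
  have key := re_trace_offDiag_le_half (blockIterate_nonneg (P := P) (Y := Y) hσ m)
    (by rw [trace_blockIterate, hY, one_pow, mul_one, (hτ 0 0).2])
    (by rw [trace_blockIterate, hY, one_pow, mul_one, (hτ 0 0).2])
    (blockIterate_diag_nonneg hσ m 0) (blockIterate_diag_nonneg hσ m 1) hproj
    ((re_trace_mul_le_of_le_add hproj horth hR hRle).trans (hRtr.trans hm))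
    ((re_trace_mul_le_of_le_add hproj.one_sub
      (by rw [sub_mul, one_mul, hproj.isIdempotentElem.eq, sub_self]) hS hSle).trans
        (hStr.trans hm))
  rwa [trace_blockIterate, (hτ 0 0).2, one_mul] at key

end Channels

/-! ### Exponentials of rotation generators. -/

section Rotations

/-- Rodrigues' formula in a Banach algebra. -/
theorem NormedSpace.exp_smul_of_cube_eq_neg {A : Type*} [NormedRing A] [NormedAlgebra ℂ A]
    [CompleteSpace A] {J : A} (hJ : J * (J * J) = -J) (θ : ℂ) :
    NormedSpace.exp (θ • J) = 1 + Complex.sin θ • J + (1 - Complex.cos θ) • (J * J) := by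
  let _ : NormedAlgebra ℚ A := NormedAlgebra.restrictScalars ℚ ℂ A
  let R : ℂ → A := fun z => 1 + Complex.sin z • J + (1 - Complex.cos z) • (J * J)
  have hR (z : ℂ) : HasDerivAt R (J * R z) z := by
    have h := (((Complex.hasDerivAt_sin z).smul_const J).const_add 1).add
      (((Complex.hasDerivAt_cos z).const_sub 1).smul_const (J * J))
    refine HasDerivAt.congr_deriv (f := R) h ?_
    simp only [R, mul_add, mul_one, mul_smul_comm, hJ]
    module
  have hE (z : ℂ) : HasDerivAt (fun u : ℂ => NormedSpace.exp (u • -J))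
      (NormedSpace.exp (z • -J) * -J) z := hasDerivAt_exp_smul_const (-J) z
  -- `R` solves `R' = J R` with `R 0 = 1`, so this product has zero derivative.
  have hconst (z : ℂ) : NormedSpace.exp (z • -J) * R z = 1 := by
    have h := is_const_of_deriv_eq_zero (𝕜 := ℂ) (f := fun z => NormedSpace.exp (z • -J) * R z)
      (fun z => ((hE z).mul (hR z)).differentiableAt)
      (fun z => ((hE z).mul (hR z)).deriv.trans (by noncomm_ring)) z 0
    simpa [R] using h
  have hinv : NormedSpace.exp (θ • J) * NormedSpace.exp (θ • -J) = 1 := by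
    rw [smul_neg, ← NormedSpace.exp_add_of_commute (Commute.neg_right rfl), add_neg_cancel,
      NormedSpace.exp_zero]
  calc NormedSpace.exp (θ • J) = NormedSpace.exp (θ • J) * (NormedSpace.exp (θ • -J) * R θ) := by
        rw [hconst, mul_one]
    _ = R θ := by rw [← mul_assoc, hinv, one_mul]

end Rotations

/-! ### Plane rotations and tilted qubit states. -/

section Qubit

variable {ι : Type*} [Fintype ι] [DecidableEq ι]

/-- The operator on `ℂ^ι` that acts as `M` on the span of the basis vectors `p 0`, `p 1` and
vanishes on the other basis vectors. -/
noncomputable def embed (p : Fin 2 → ι) (M : Matrix (Fin 2) (Fin 2) ℂ) : Matrix ι ι ℂ :=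
  (1 : Matrix ι ι ℂ).submatrix id p * M * (1 : Matrix ι ι ℂ).submatrix p id

variable {p : Fin 2 → ι}

theorem embed_mul (hp : Function.Injective p) (M N : Matrix (Fin 2) (Fin 2) ℂ) :
    embed p (M * N) = embed p M * embed p N := by
  have h : (1 : Matrix ι ι ℂ).submatrix p id * (1 : Matrix ι ι ℂ).submatrix id p = 1 := by
    rw [← Matrix.submatrix_mul _ _ p id p Function.bijective_id, mul_one,
      Matrix.submatrix_one _ hp]
  simp only [embed, Matrix.mul_assoc]
  rw [← Matrix.mul_assoc (Matrix.submatrix 1 p id) (Matrix.submatrix 1 id p), h, Matrix.one_mul]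

theorem trace_embed (hp : Function.Injective p) (M : Matrix (Fin 2) (Fin 2) ℂ) :
    (embed p M).trace = M.trace := by
  rw [embed, Matrix.trace_mul_comm, ← Matrix.mul_assoc,
    ← Matrix.submatrix_mul _ _ p id p Function.bijective_id, mul_one, Matrix.submatrix_one _ hp,
    Matrix.one_mul]

omit [Fintype ι] in
theorem star_embed (M : Matrix (Fin 2) (Fin 2) ℂ) : star (embed p M) = embed p (star M) := by
  simp [embed, Matrix.star_eq_conjTranspose, Matrix.conjTranspose_mul, Matrix.mul_assoc]

omit [Fintype ι] in
theorem embed_add (M N : Matrix (Fin 2) (Fin 2) ℂ) :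
    embed p (M + N) = embed p M + embed p N := by
  simp [embed, Matrix.mul_add, Matrix.add_mul]

omit [Fintype ι] in
theorem embed_smul (c : ℂ) (M : Matrix (Fin 2) (Fin 2) ℂ) :
    embed p (c • M) = c • embed p M := by
  simp [embed]

omit [Fintype ι] in
theorem embed_sub (M N : Matrix (Fin 2) (Fin 2) ℂ) :
    embed p (M - N) = embed p M - embed p N := by
  simp [embed, Matrix.mul_sub, Matrix.sub_mul]

omit [DecidableEq ι] in
theorem isDensity_star_mul_self {A : Matrix ι ι ℂ} (h : (star A * A).trace = 1) :
    IsDensity (star A * A) :=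
  ⟨Matrix.nonneg_iff_posSemidef.1 (star_mul_self_nonneg A), h⟩

/-- The generator of the rotations of the plane. -/
def planeGenerator : Matrix (Fin 2) (Fin 2) ℂ := !![0, -1; 1, 0]

/-- The projection onto the line at angle `φ` of the plane. -/
noncomputable def lineProjection (φ : ℝ) : Matrix (Fin 2) (Fin 2) ℂ :=
  !![(Real.cos φ : ℂ) ^ 2, (Real.cos φ : ℂ) * (Real.sin φ : ℂ);
    (Real.cos φ : ℂ) * (Real.sin φ : ℂ), (Real.sin φ : ℂ) ^ 2]

theorem planeGenerator_mul_self : planeGenerator * planeGenerator = -1 := by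
  ext i j
  fin_cases i <;> fin_cases j <;> simp [planeGenerator]

theorem exp_embed_planeGenerator (hp : Function.Injective p) (θ : ℂ) :
    NormedSpace.exp (θ • embed p planeGenerator) = 1 + Complex.sin θ • embed p planeGenerator +
      (1 - Complex.cos θ) • embed p (-1) := by
  rw [NormedSpace.exp_smul_of_cube_eq_neg, ← embed_mul hp, planeGenerator_mul_self]
  rw [← embed_mul hp, ← embed_mul hp, planeGenerator_mul_self, mul_neg, mul_one,
    ← neg_one_smul ℂ planeGenerator, embed_smul, neg_one_smul]

theorem exp_mul_embed_mul_exp (hp : Function.Injective p) (φ θ : ℝ) :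
    NormedSpace.exp ((θ : ℂ) • embed p planeGenerator) * embed p (lineProjection φ) *
      NormedSpace.exp ((-θ : ℂ) • embed p planeGenerator) =
    embed p (lineProjection (φ + θ)) := by
  have h (z : ℂ) : NormedSpace.exp (z • embed p planeGenerator) = 1 + embed p
      (Complex.sin z • planeGenerator + (1 - Complex.cos z) • (-1)) := by
    rw [exp_embed_planeGenerator hp, embed_add, embed_smul, embed_smul, add_assoc]
  rw [h, h, add_mul, one_mul, mul_add, mul_one, ← embed_mul hp, ← embed_add, ← embed_mul hp,
    ← embed_add]
  congr 1
  ext i j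
  fin_cases i <;> fin_cases j <;>
    simp [planeGenerator, lineProjection, Matrix.mul_apply, Fin.sum_univ_two,
      Complex.cos_add, Complex.sin_add] <;> ring

theorem evolve_lineProjection (hp : Function.Injective p) {ρ₁ ρ₂ : Matrix ι ι ℂ} {t θ : ℝ}
    (h : (t : ℂ) • (ρ₁ * ρ₂ - ρ₂ * ρ₁) = (θ : ℂ) • embed p planeGenerator) (φ : ℝ) :
    evolve (commHamiltonian ρ₁ ρ₂) t (embed p (lineProjection φ)) =
      embed p (lineProjection (φ + θ)) := by
  have h1 : (-(Complex.I * (t : ℂ))) • commHamiltonian ρ₁ ρ₂ =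
      (θ : ℂ) • embed p planeGenerator := by
    rw [commHamiltonian, smul_smul, ← h]
    congr 1
    linear_combination (-(t : ℂ)) * Complex.I_mul_I
  have h2 : (Complex.I * (t : ℂ)) • commHamiltonian ρ₁ ρ₂ =
      (-θ : ℂ) • embed p planeGenerator := by
    rw [neg_smul, ← h1, neg_smul, neg_neg]
  rw [evolve, h1, h2, exp_mul_embed_mul_exp hp]

theorem star_lineProjection (φ : ℝ) : star (lineProjection φ) = lineProjection φ := by
  ext i j
  fin_cases i <;> fin_cases j <;>
    simp [lineProjection, Matrix.star_apply,
      -Complex.ofReal_cos, -Complex.ofReal_sin]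

theorem lineProjection_mul_self (φ : ℝ) :
    lineProjection φ * lineProjection φ = lineProjection φ := by
  have h : (Real.cos φ : ℂ) ^ 2 + (Real.sin φ : ℂ) ^ 2 = 1 := by
    exact_mod_cast Real.cos_sq_add_sin_sq φ
  ext i j
  fin_cases i <;> fin_cases j <;>
    simp only [lineProjection, Matrix.mul_apply, Fin.sum_univ_two, Fin.zero_eta, Fin.mk_one,
      Matrix.of_apply, Matrix.cons_val', Matrix.cons_val_zero, Matrix.cons_val_one,
      Matrix.cons_val_fin_one]
  · linear_combination (Real.cos φ : ℂ) ^ 2 * h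
  · linear_combination (Real.cos φ : ℂ) * (Real.sin φ : ℂ) * h
  · linear_combination (Real.cos φ : ℂ) * (Real.sin φ : ℂ) * h
  · linear_combination (Real.sin φ : ℂ) ^ 2 * h

theorem trace_lineProjection (φ : ℝ) : (lineProjection φ).trace = 1 := by
  rw [Matrix.trace_fin_two]
  simp [lineProjection]

theorem lineProjection_mul_eq_zero :
    lineProjection (-(Real.pi / 4)) * lineProjection (Real.pi / 4) = 0 := by
  ext i j
  fin_cases i <;> fin_cases j <;>
    simp [lineProjection, Matrix.mul_apply, Fin.sum_univ_two,
      -Complex.ofReal_cos, -Complex.ofReal_sin] <;> ring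

theorem isStarProjection_embed_lineProjection (hp : Function.Injective p) (φ : ℝ) :
    IsStarProjection (embed p (lineProjection φ)) :=
  ⟨by rw [IsIdempotentElem, ← embed_mul hp, lineProjection_mul_self],
    by rw [IsSelfAdjoint, star_embed, star_lineProjection]⟩

theorem isDensity_embed_lineProjection (hp : Function.Injective p) (φ : ℝ) :
    IsDensity (embed p (lineProjection φ)) := by
  have h := isStarProjection_embed_lineProjection hp φ
  exact ⟨Matrix.nonneg_iff_posSemidef.1 h.nonneg, by rw [trace_embed hp, trace_lineProjection]⟩

/-- The square root of the qubit state with eigenvalues `a ^ 2`, `b ^ 2` and eigenvectors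
`(1, 1)`, `(1, -1)`. -/
noncomputable def tiltedRoot (a b : ℝ) : Matrix (Fin 2) (Fin 2) ℂ :=
  !![((a + b) / 2 : ℂ), ((a - b) / 2 : ℂ); ((a - b) / 2 : ℂ), ((a + b) / 2 : ℂ)]

theorem star_tiltedRoot (a b : ℝ) : star (tiltedRoot a b) = tiltedRoot a b := by
  ext i j
  fin_cases i <;> fin_cases j <;> simp [tiltedRoot, Matrix.star_apply]

theorem trace_tiltedRoot_mul (a b c d : ℝ) :
    (star (tiltedRoot a b) * tiltedRoot c d).trace = ((a * c + b * d : ℝ) : ℂ) := by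
  rw [star_tiltedRoot, Matrix.trace_fin_two]
  simp [tiltedRoot, Matrix.mul_apply, Fin.sum_univ_two]
  ring

/-- Swapping `a` and `b` reverses the sense of rotation; this gives the two opposite evolutions. -/
theorem tiltedRoot_commutator (a b : ℝ) :
    star (tiltedRoot a b) * tiltedRoot a b * lineProjection 0 -
      lineProjection 0 * (star (tiltedRoot a b) * tiltedRoot a b) =
    (((a ^ 2 - b ^ 2) / 2 : ℝ) : ℂ) • planeGenerator := by
  rw [star_tiltedRoot]
  ext i j
  fin_cases i <;> fin_cases j <;>
    simp [tiltedRoot, lineProjection, planeGenerator] <;> ring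

end Qubit

/-! ### From simulation to sample bounds. -/

section Simulation

variable {ι : Type*} [Fintype ι] [DecidableEq ι] {n₁ n₂ : ℕ}

/-- Both runs start from the line at angle `0`; every step rotates it by `θ i`, so after `m` steps
the ideal lines are perpendicular. -/
theorem overlap_pow_le_half {p : Fin 2 → ι} (hp : Function.Injective p)
    {P : SampleProtocol ι n₁ n₂} {t δ : ℝ} (hP : SimulatesCommutator P t δ) {m : ℕ}
    (hm : m * δ ≤ 1 / 16) {A B : Fin 2 → Matrix (Fin 2) (Fin 2) ℂ}
    (hA : ∀ i, (star (A i) * A i).trace = 1) (hB : ∀ i, (star (B i) * B i).trace = 1)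
    {θ : Fin 2 → ℝ} (hθ₀ : m * θ 0 = Real.pi / 4) (hθ₁ : m * θ 1 = -(Real.pi / 4))
    (hAB : ∀ i, (t : ℂ) • (star (A i) * A i * (star (B i) * B i) -
      star (B i) * B i * (star (A i) * A i)) = (θ i : ℂ) • planeGenerator) :
    ((((star (A 0) * A 1).trace ^ n₁ * (star (B 0) * B 1).trace ^ n₂) ^ m).re ≤ 1 / 2) := by
  let Y : Fin 2 → Matrix ((Fin n₁ → ι) × (Fin n₂ → ι)) ((Fin n₁ → ι) × (Fin n₂ → ι)) ℂ :=
    fun i => copies (embed p (A i)) n₁ ⊗ₖ copies (embed p (B i)) n₂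
  have hY (i j : Fin 2) : star (Y i) * Y j =
      copies (embed p (star (A i) * A j)) n₁ ⊗ₖ copies (embed p (star (B i) * B j)) n₂ := by
    simp only [Y, embed_mul hp, copies_mul, Matrix.mul_kronecker_mul, ← star_embed]
    simp only [Matrix.star_eq_conjTranspose, Matrix.conjTranspose_kronecker, conjTranspose_copies]
  have htr (i j : Fin 2) : (star (Y i) * Y j).trace =
      (star (A i) * A j).trace ^ n₁ * (star (B i) * B j).trace ^ n₂ := by
    rw [hY, Matrix.trace_kronecker, trace_copies, trace_copies, trace_embed hp, trace_embed hp]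
  rw [← htr]
  refine re_overlap_pow_le_half (P := P) (τ := fun i k => embed p (lineProjection (k * θ i)))
    (fun i => by rw [htr, hA, hB, one_pow, one_pow, one_mul])
    (fun i k => isDensity_embed_lineProjection hp _) (fun i k => ?_) (by simp)
    (isStarProjection_embed_lineProjection hp _) ?_ hm
  · have hdens {M : Matrix (Fin 2) (Fin 2) ℂ} (hM : (star M * M).trace = 1) :
        IsDensity (embed p (star M * M)) := by
      rw [embed_mul hp, ← star_embed]
      exact isDensity_star_mul_self
        (by rw [star_embed, ← embed_mul hp, trace_embed hp, hM])
    have hev := evolve_lineProjection hp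
      (ρ₁ := embed p (star (A i) * A i)) (ρ₂ := embed p (star (B i) * B i))
      (by rw [← embed_mul hp, ← embed_mul hp, ← embed_sub, ← embed_smul, hAB, embed_smul]) (k * θ i)
    have h := hP _ _ (hdens (hA i)) (hdens (hB i)) _
      (isDensity_embed_lineProjection hp (k * θ i))
    rw [hev] at h
    rw [hY]
    convert h using 6
    push_cast
    ring_nf
  · simp only [hθ₀, hθ₁]
    rw [← embed_mul hp, lineProjection_mul_eq_zero]
    simp [embed]

/-- Here `(2ab)² = (a² + b²)² - (a² - b²)² = 1 - ε²`; squaring the hypothesis and Bernoulli give `1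
- Nε² ≤ 1/4`. -/
theorem three_fourths_le_of_overlap {a b ε : ℝ} (ha : 0 ≤ a) (hb : 0 ≤ b)
    (hab : a ^ 2 + b ^ 2 = 1) (hε : a ^ 2 - b ^ 2 = ε) {N : ℕ}
    (h : (2 * a * b) ^ N ≤ 1 / 2) : 3 / 4 ≤ N * ε ^ 2 := by
  have h1 : ((2 * a * b) ^ N) ^ 2 ≤ (1 / 2) ^ 2 := pow_le_pow_left₀ (by positivity) h 2
  have h2 : (2 * a * b) ^ 2 = 1 + -ε ^ 2 := by
    rw [← hε]
    linear_combination (a ^ 2 + b ^ 2 + 1) * hab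
  have h3 : -2 ≤ -ε ^ 2 := by nlinarith [sq_nonneg (2 * a * b)]
  have h4 := one_add_mul_le_pow h3 N
  rw [← h2, ← pow_mul, mul_comm 2 N, pow_mul] at h4
  linarith

theorem exists_tilt {ε : ℝ} (hε : |ε| ≤ 1) :
    ∃ a b : ℝ, 0 ≤ a ∧ 0 ≤ b ∧ a ^ 2 + b ^ 2 = 1 ∧ a ^ 2 - b ^ 2 = ε := by
  obtain ⟨h1, h2⟩ := abs_le.1 hε
  refine ⟨√((1 + ε) / 2), √((1 - ε) / 2), Real.sqrt_nonneg _, Real.sqrt_nonneg _, ?_, ?_⟩ <;>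
    rw [Real.sq_sqrt (by linarith), Real.sq_sqrt (by linarith)] <;> ring

/-- A protocol all of whose `m` successive uses have total error at most `1 / 16` consumes enough
copies to tell apart the states tilted by `± ε` that it steers to orthogonal states. -/
theorem sample_bounds {p : Fin 2 → ι} (hp : Function.Injective p)
    {P : SampleProtocol ι n₁ n₂} {t δ ε : ℝ} (hP : SimulatesCommutator P t δ) {m : ℕ}
    (hm : m * δ ≤ 1 / 16) (hε : |ε| ≤ 1) (hmε : m * (t * ε / 2) = Real.pi / 4) :
    3 / 4 ≤ (n₁ * m : ℝ) * ε ^ 2 ∧ 3 / 4 ≤ (n₂ * m : ℝ) * ε ^ 2 := by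
  have hF : (star (lineProjection 0) * lineProjection 0).trace = 1 := by
    rw [star_lineProjection, lineProjection_mul_self, trace_lineProjection]
  have hFF : star (lineProjection 0) * lineProjection 0 = lineProjection 0 := by
    rw [star_lineProjection, lineProjection_mul_self]
  constructor
  · obtain ⟨a, b, ha, hb, hab, habε⟩ := exists_tilt hε
    have key := overlap_pow_le_half hp hP hm (A := ![tiltedRoot a b, tiltedRoot b a])
      (B := fun _ => lineProjection 0) (θ := ![t * ε / 2, -(t * ε / 2)])
      (by
        intro i
        fin_cases i <;> simp only [Fin.zero_eta, Fin.mk_one, Matrix.cons_val_zero,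
          Matrix.cons_val_one, trace_tiltedRoot_mul] <;> norm_cast <;> linarith)
      (fun _ => hF) hmε (by simpa using hmε)
      (by
        intro i
        rw [hFF]
        fin_cases i <;> simp only [Fin.zero_eta, Fin.mk_one, Matrix.cons_val_zero,
          Matrix.cons_val_one, tiltedRoot_commutator, smul_smul] <;> congr 1 <;> norm_cast <;>
          rw [← habε] <;> ring)
    simp only [Matrix.cons_val_zero, Matrix.cons_val_one, trace_tiltedRoot_mul, hF, one_pow,
      mul_one, ← pow_mul] at key
    norm_cast at key
    exact_mod_cast three_fourths_le_of_overlap ha hb hab habε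
      (by convert key using 2; ring)
  -- Tilting the second state instead flips the sign of the commutator, which `-ε` compensates.
  · obtain ⟨a, b, ha, hb, hab, habε⟩ := exists_tilt (ε := -ε) (by rwa [abs_neg])
    have key := overlap_pow_le_half hp hP hm (B := ![tiltedRoot a b, tiltedRoot b a])
      (A := fun _ => lineProjection 0) (θ := ![t * ε / 2, -(t * ε / 2)])
      (fun _ => hF)
      (by
        intro i
        fin_cases i <;> simp only [Fin.zero_eta, Fin.mk_one, Matrix.cons_val_zero,
          Matrix.cons_val_one, trace_tiltedRoot_mul] <;> norm_cast <;> linarith)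
      hmε (by simpa using hmε)
      (by
        intro i
        rw [hFF, ← neg_sub, smul_neg, ← neg_smul]
        fin_cases i <;> simp only [Fin.zero_eta, Fin.mk_one, Matrix.cons_val_zero,
          Matrix.cons_val_one, tiltedRoot_commutator, smul_smul] <;> congr 1 <;> norm_cast <;>
          rw [← neg_eq_iff_eq_neg.2 habε] <;> ring)
    simp only [Matrix.cons_val_zero, Matrix.cons_val_one, trace_tiltedRoot_mul, hF, one_pow,
      one_mul, ← pow_mul] at key
    norm_cast at key
    have h := three_fourths_le_of_overlap ha hb hab habε (N := n₂ * m)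
      (by convert key using 2; ring)
    rw [neg_sq] at h
    exact_mod_cast h

end Simulation

/-! ### Choice of constants. -/

theorem mainTheorem6 :
    ∃ C δ₀ κ : ℝ, 0 < C ∧ 0 < δ₀ ∧ 0 < κ ∧
      ∀ d : ℕ, 2 ≤ d →
        ∀ t δ : ℝ, t ≠ 0 → 0 < δ → δ ≤ δ₀ → δ / |t| ≤ κ →
          ∀ (n₁ n₂ : ℕ) (P : SampleProtocol (Fin d) n₁ n₂), SimulatesCommutator P t δ →
            C * t ^ 2 / δ ≤ (n₁ : ℝ) ∧ C * t ^ 2 / δ ≤ (n₂ : ℝ) := by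
  -- `δ ≤ 1/16` gives `m ≥ 1`, hence `mδ ≥ 1/32`; with `|t| ≥ 64δ` this yields `2m|t| ≥ 4 > π`, so
  -- the tilt is admissible. Using `π² ≤ 10`, the bound obtained is `3t²/(320δ)`, better than
  -- `t²/(200δ)`.
  refine ⟨1 / 200, 1 / 16, 1 / 64, by norm_num, by norm_num, by norm_num, ?_⟩
  intro d hd t δ ht hδ hδ₀ hκ n₁ n₂ P hP
  have hπ := Real.pi_pos
  have hπ' := Real.pi_lt_d2
  have ht' : 0 < |t| := abs_pos.2 ht
  let m : ℕ := ⌊1 / (16 * δ)⌋₊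
  have hm₁ : (1 : ℝ) ≤ m := by
    exact_mod_cast Nat.le_floor (by rw [Nat.cast_one, le_div_iff₀ (by positivity)]; linarith)
  have hmδ : m * δ ≤ 1 / 16 := by
    have h : (m : ℝ) ≤ 1 / (16 * δ) := Nat.floor_le (by positivity)
    rw [le_div_iff₀ (by positivity)] at h
    linarith
  have hmδ' : 1 / 32 ≤ m * δ := by
    have h : 1 / (16 * δ) < m + 1 := Nat.lt_floor_add_one _
    rw [div_lt_iff₀ (by positivity)] at h
    nlinarith
  have hm₀ : (0 : ℝ) < m := by linarith
  have hε : |Real.pi / (2 * m * t)| ≤ 1 := by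
    rw [abs_div, abs_mul, abs_of_pos hπ, abs_of_pos (by positivity : (0 : ℝ) < 2 * m),
      div_le_one (by positivity)]
    rw [div_le_iff₀ ht'] at hκ
    nlinarith
  have hp : Function.Injective (![⟨0, by omega⟩, ⟨1, by omega⟩] : Fin 2 → Fin d) := by
    intro i j
    fin_cases i <;> fin_cases j <;> simp
  have hbound {n : ℕ} (h : 3 / 4 ≤ (n * m : ℝ) * (Real.pi / (2 * m * t)) ^ 2) :
      1 / 200 * t ^ 2 / δ ≤ n := by
    have h1 : (n * m : ℝ) * (Real.pi / (2 * m * t)) ^ 2 = n * Real.pi ^ 2 / (4 * m * t ^ 2) := by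
      field_simp
      ring
    rw [h1, le_div_iff₀ (by positivity)] at h
    rw [div_le_iff₀ hδ]
    have h2 : Real.pi ^ 2 ≤ 10 := by nlinarith
    have h3 : 3 * (m * t ^ 2) ≤ n * 10 := by
      linarith [mul_le_mul_of_nonneg_left h2 (Nat.cast_nonneg (α := ℝ) n)]
    have h4 : 1 / 32 * t ^ 2 ≤ m * δ * t ^ 2 := by gcongr
    have h5 := mul_le_mul_of_nonneg_right h3 hδ.le
    nlinarith [sq_nonneg t]
  obtain ⟨h₁, h₂⟩ := sample_bounds hp hP hmδ hε (by field_simp; ring)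
  exact ⟨hbound h₁, hbound h₂⟩
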